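/- Let $a\ge 2$ and $r\ge 1$ be integers, let $H=\langle a,a+1,\dots,a+r\rangle\subseteq\mathbb N$ be the numerical semigroup generated by $a,a+1,\dots,a+r$, let $k$ be an infinite field, and let $R=k[[H]]$ be the (completed) numerical semigroup ring, i.e. the subring of $k[[t]]$ consisting of all power series $\sum_{h\in H}c_ht^h$ with $c_h\in k$. Let $\mathfrak c=R:_QS$ be the conductor of $R$, where $Q$ is the total quotient ring of $R$ and $S$ is the integral closure of $R$ in $Q$; it is an ideal of $R$. Let $\operatorname{mod}R$ be the category of finitely generated $R$-modules. A subcategory means a nonempty strictly full subcategory (one closed under isomorphism). Write $\operatorname{fl}R$ for the subcategory of modules of finite length, $\operatorname{tf}R$ for that of torsionfree modules, and $0$ for that of zero modules. For $M\in\operatorname{mod}R$, let $\operatorname{ext}_RM$ be the smallest subcategory of $\operatorname{mod}R$ that contains $M$ and is closed under direct summands and extensions. A subcategory is IKE-closed if it is closed under images, kernels and extensions, and it is torsionfree if it is closed under subobjects and extensions. Then the following hold. (1) $\operatorname{ext}_R(R/\mathfrak c)=\operatorname{fl}R$ and $\operatorname{ext}_R\mathfrak c=\operatorname{tf}R$.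 (2) The IKE-closed subcategories of $\operatorname{mod}R$ are exactly $0$, $\operatorname{fl}R$, $\operatorname{tf}R$ and $\operatorname{mod}R$. In particular, every IKE-closed subcategory of $\operatorname{mod}R$ is torsionfree. -/

import Mathlib

open CategoryTheory

universe u v

namespace IKE

/-! ### Numerical semigroup rings -/

/-- The numerical semigroup `⟨a, a + 1, …, a + r⟩`, a submonoid of `(ℕ, +)`. -/
def consecutiveSemigroup (a r : ℕ) : AddSubmonoid ℕ :=
  AddSubmonoid.closure (Set.Icc a (a + r))

/-- The (completed) numerical semigroup ring `k⟦H⟧ = k⟦t ^ h | h ∈ H⟧`: the subring of the power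
series ring `k⟦t⟧` of all power series in which only monomials `t ^ h` with `h ∈ H` occur. -/
def semigroupRing (k : Type u) [Field k] (H : AddSubmonoid ℕ) : Subalgebra k (PowerSeries k) where
  carrier := {f | ∀ n : ℕ, PowerSeries.coeff n f ≠ 0 → n ∈ H}
  mul_mem' := by
    intro f g hf hg n hn
    rw [PowerSeries.coeff_mul] at hn
    obtain ⟨p, hp, hne⟩ := Finset.exists_ne_zero_of_sum_ne_zero hn
    rw [← Finset.HasAntidiagonal.mem_antidiagonal.mp hp]
    exact H.add_mem (hf _ (left_ne_zero_of_mul hne)) (hg _ (right_ne_zero_of_mul hne))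
  add_mem' := by
    intro f g hf hg n hn
    by_cases h : PowerSeries.coeff n f = 0
    · exact hg n (by simpa [h] using hn)
    · exact hf n h
  algebraMap_mem' := by
    intro c n hn
    rw [PowerSeries.algebraMap_apply, PowerSeries.coeff_C] at hn
    by_cases h : n = 0
    · exact h ▸ H.zero_mem
    · simp [h] at hn

/-- The conductor `R :_Q S` of a ring `R`, where `Q` is the total quotient ring of `R` and `S` is
the integral closure of `R` in `Q`. As `1 ∈ S`, it is contained in `R`, and it is regarded as an
ideal of `R`. -/
noncomputable def conductor (R : Type u) [CommRing R] : Ideal R :=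
  Submodule.comap (Algebra.linearMap R (FractionRing R))
    (1 / Subalgebra.toSubmodule (integralClosure R (FractionRing R)))

/-! ### Subcategories of `mod R`

A strictly full subcategory of the category `mod R` of finitely generated modules over a noetherian
ring `R` is given by its objects: an isomorphism-invariant property of `R`-modules implying
`ModuleCat.isFG R`, that is, finite generation. -/

section

variable {R : Type u} [CommRing R]

/-- `P` is a strictly full subcategory of `mod R`. Like every subcategory it has an object. -/
structure IsSubcategory (P : ObjectProperty (ModuleCat.{v} R)) : Prop where
  le_isFG : P ≤ ModuleCat.isFG R
  isoClosed : P.IsClosedUnderIsomorphisms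
  nonempty : P.Nonempty

/-- IKE-closed subcategories of `mod R`: those closed under images, kernels and extensions. -/
structure IsIKEClosed (P : ObjectProperty (ModuleCat.{v} R)) : Prop extends IsSubcategory P where
  images : ∀ ⦃M N : ModuleCat.{v} R⦄ (f : M ⟶ N), P M → P N →
    P (ModuleCat.of R (LinearMap.range f.hom))
  kernels : P.IsClosedUnderKernels
  extensions : P.IsClosedUnderExtensions

/-- Torsionfree subcategories of `mod R`: those closed under subobjects and extensions. -/
structure IsTorsionFreeSubcategory (P : ObjectProperty (ModuleCat.{v} R)) : Prop
    extends IsSubcategory P where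
  subobjects : P.IsClosedUnderSubobjects
  extensions : P.IsClosedUnderExtensions

/-- The extension closure `ext_R M` of a finitely generated module `M`: the smallest subcategory of
`mod R` that contains `M` and is closed under direct summands and extensions. -/
def extClosure (M : ModuleCat.{v} R) : ObjectProperty (ModuleCat.{v} R) :=
  sInf {P | IsSubcategory P ∧ P.IsStableUnderRetracts ∧ P.IsClosedUnderExtensions ∧ P M}

end

section

variable (R : Type u) [CommRing R]

/-- The zero subcategory. -/
def zeroSubcategory : ObjectProperty (ModuleCat.{v} R) := fun M => Subsingleton M

/-- `fl R`: the modules of finite length. -/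
def fl : ObjectProperty (ModuleCat.{v} R) := fun M => IsFiniteLength R M

/-- `tf R`: the finitely generated torsionfree modules. -/
def tf : ObjectProperty (ModuleCat.{v} R) :=
  fun M => Module.Finite R M ∧ Module.IsTorsionFree R M

end

end IKE

/-!
Write `x = t ^ a` and let `n` be minimal with `a - 1 ≤ n * r`. The semigroup `H` consists of the
intervals `[m a, m (a + r)]`, so every exponent `≥ n a` lies in `H`, while `n a - 1` does not.
Hence, with `S = k⟦t⟧`, the conductor is `x ^ n S ≅ S`; moreover `R = k + 𝔪` with `𝔪 S ⊆ x S`.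
These facts (`HasPowConductor`) are all that is used of `R`.

The basic tool is `prop_fst_of_exact`: if `0 → L → M × M' → N → 0` is exact, then a class closed
under extensions and direct summands that contains `L` and `N` contains `M`.

* `ext S = tf`. For a submodule `I ⊆ S` with `x ^ (j + 1) S ⊆ I ⊆ x ^ j S`, a `k`-complement `J` of
  `I` relative to these bounds is an `R`-submodule because `𝔪 S ⊆ x S`, so that `I ∩ J` and `I + J`
  are both isomorphic to `S`, and `0 → I ∩ J → I × J → I + J → 0` puts `I` into `ext S`. The same
  sequence for `I` and `x ^ (j + 1) S` gives all submodules of `S` by induction, and every finitely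
  generated torsionfree module is an iterated extension of such modules.
* `ext (R ⧸ 𝔠) = fl`. Put `C i = R ∩ x ^ i S`, so `𝔠 = C n` and `𝔪 = C 1`. Multiplication by `x`
  embeds `C i / C (i + 1)` into `C (i + 1) / C (i + 2)`; a complement of the image gives an ideal
  `J` and an exact sequence `0 → R ⧸ C (i + 1) → R ⧸ C i × R ⧸ J → R ⧸ C (i + 1) → 0`. Descending
  from `i + 1 = n`, one reaches `R ⧸ C 1 = k`, whose iterated extensions are all of `fl`.
* Let `P` be IKE-closed. If some `M` in `P` has torsion, then `k` is the image of an endomorphism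
  `M → k → M`, so `fl ⊆ P`. If `P` contains a torsionfree `N ≠ 0`, then it contains `Hom_R(S, N)`,
  a kernel of a map between powers of `N`; an endomorphism of `Hom_R(S, N)` has image `S`, so
  `tf ⊆ P`. Finally, if `r` kills the torsion of `M`, then `r M` is torsionfree and is the image of
  an endomorphism of `M`; so `P` contains a torsionfree module as soon as it contains a module not
  of finite length.
-/

namespace IKE

/-! ### Closure properties in terms of linear maps -/

section

variable {R : Type u} [CommRing R] {P : ObjectProperty (ModuleCat.{v} R)}
  {L M N : Type v} [AddCommGroup L] [Module R L] [AddCommGroup M] [Module R M]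
  [AddCommGroup N] [Module R N]

lemma prop_of_linearEquiv [P.IsClosedUnderIsomorphisms] (e : M ≃ₗ[R] N)
    (h : P (ModuleCat.of R M)) : P (ModuleCat.of R N) :=
  P.prop_of_iso e.toModuleIso h

lemma prop_of_leftInverse [P.IsStableUnderRetracts] (i : M →ₗ[R] N) (p : N →ₗ[R] M)
    (hpi : ∀ x, p (i x) = x) (h : P (ModuleCat.of R N)) : P (ModuleCat.of R M) :=
  P.prop_of_retract
    { i := ModuleCat.ofHom i
      r := ModuleCat.ofHom p
      retract := by ext x; exact hpi x } h

lemma prop_of_exact [P.IsClosedUnderExtensions] (f : L →ₗ[R] M) (g : M →ₗ[R] N)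
    (hf : Function.Injective f) (hg : Function.Surjective g) (hfg : Function.Exact f g)
    (hL : P (ModuleCat.of R L)) (hN : P (ModuleCat.of R N)) : P (ModuleCat.of R M) := by
  let S : ShortComplex (ModuleCat.{v} R) :=
    ShortComplex.mk (ModuleCat.ofHom f) (ModuleCat.ofHom g)
      (by ext x; exact hfg.apply_apply_eq_zero x)
  have hS : S.ShortExact :=
    { exact := (ShortComplex.ShortExact.moduleCat_exact_iff_function_exact S).mpr hfg
      mono_f := (ModuleCat.mono_iff_injective _).mpr hf
      epi_g := (ModuleCat.epi_iff_surjective _).mpr hg }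
  exact P.prop_X₂_of_shortExact hS hL hN

lemma prop_of_leftExact [P.IsClosedUnderKernels] (f : L →ₗ[R] M) (g : M →ₗ[R] N)
    (hf : Function.Injective f) (hfg : Function.Exact f g)
    (hM : P (ModuleCat.of R M)) (hN : P (ModuleCat.of R N)) : P (ModuleCat.of R L) :=
  P.prop_of_isLimit_kernelFork
    (ModuleCat.isLimitKernelFork (ModuleCat.ofHom f) (ModuleCat.ofHom g) hfg hf) hM hN

lemma prop_prod [P.IsClosedUnderExtensions] (hM : P (ModuleCat.of R M))
    (hN : P (ModuleCat.of R N)) : P (ModuleCat.of R (M × N)) :=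
  prop_of_exact (LinearMap.inl R M N) (LinearMap.snd R M N) LinearMap.inl_injective
    LinearMap.snd_surjective Function.Exact.inl_snd hM hN

/-- A class of modules closed under extensions and direct summands contains each summand of the
middle term of a short exact sequence whose outer terms it contains. -/
lemma prop_fst_of_exact [P.IsStableUnderRetracts] [P.IsClosedUnderExtensions]
    {M' : Type v} [AddCommGroup M'] [Module R M'] (f : L →ₗ[R] M × M') (g : M × M' →ₗ[R] N)
    (hf : Function.Injective f) (hg : Function.Surjective g) (hfg : Function.Exact f g)
    (hL : P (ModuleCat.of R L)) (hN : P (ModuleCat.of R N)) : P (ModuleCat.of R M) :=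
  prop_of_leftInverse (LinearMap.inl R M M') (LinearMap.fst R M M') (fun _ => rfl)
    (prop_of_exact f g hf hg hfg hL hN)

/-- By the Mayer–Vietoris sequence `0 → A ⊓ B → A × B → A ⊔ B → 0`, a class of modules closed
under extensions and direct summands contains `A` as soon as it contains `A ⊓ B` and `A ⊔ B`. -/
lemma prop_of_inf_sup [P.IsStableUnderRetracts] [P.IsClosedUnderExtensions] {A B : Submodule R M}
    (hinf : P (ModuleCat.of R ↥(A ⊓ B))) (hsup : P (ModuleCat.of R ↥(A ⊔ B))) :
    P (ModuleCat.of R A) := by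
  refine prop_fst_of_exact (M' := B)
    ((Submodule.inclusion inf_le_left).prod (Submodule.inclusion inf_le_right))
    ((Submodule.inclusion le_sup_left).coprod (-Submodule.inclusion le_sup_right)) ?_ ?_ ?_
    hinf hsup
  · intro x y h
    exact Subtype.ext (congrArg (fun z : A × B => (z.1 : M)) h)
  · rintro ⟨z, hz⟩
    obtain ⟨p, hp, q, hq, rfl⟩ := Submodule.mem_sup.mp hz
    exact ⟨(⟨p, hp⟩, -⟨q, hq⟩), Subtype.ext (by simp)⟩
  · rintro ⟨⟨p, hp⟩, ⟨q, hq⟩⟩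
    simp only [Subtype.ext_iff, LinearMap.coprod_apply, LinearMap.neg_apply,
      Submodule.coe_inclusion, Set.mem_range, LinearMap.prod_apply, Function.prod, Prod.ext_iff,
      add_neg_eq_zero]
    constructor
    · rintro rfl
      exact ⟨⟨p, hp, hq⟩, rfl, rfl⟩
    · rintro ⟨y, rfl, rfl⟩
      rfl

lemma prop_pi_fin [P.IsClosedUnderIsomorphisms] [P.IsClosedUnderExtensions]
    (h0 : P (ModuleCat.of R PUnit.{v + 1})) (hM : P (ModuleCat.of R M)) (n : ℕ) :
    P (ModuleCat.of R (Fin n → M)) := by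
  induction n with
  | zero =>
    exact prop_of_linearEquiv (M := PUnit.{v + 1})
      { toFun := fun _ => 0
        invFun := fun _ => 0
        map_add' := by simp
        map_smul' := by simp
        left_inv := fun _ => rfl
        right_inv := fun _ => Subsingleton.elim _ _ } h0
  | succ n ih => exact prop_of_linearEquiv (Fin.consLinearEquiv R (fun _ => M)) (prop_prod hM ih)

namespace IsIKEClosed

lemma range (hP : IsIKEClosed P) (f : M →ₗ[R] N) (hM : P (ModuleCat.of R M))
    (hN : P (ModuleCat.of R N)) : P (ModuleCat.of R (LinearMap.range f)) :=
  hP.images (ModuleCat.ofHom f) hM hN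

/-- A direct summand is the image of an idempotent endomorphism. -/
lemma isStableUnderRetracts (hP : IsIKEClosed P) : P.IsStableUnderRetracts where
  of_retract {X Y} h hY := by
    have := hP.isoClosed
    have hpi (x : X) : h.r.hom (h.i.hom x) = x := congr($(h.retract).hom x)
    have hi : Function.Injective h.i.hom := Function.LeftInverse.injective hpi
    have hr : LinearMap.range (h.i.hom ∘ₗ h.r.hom) = LinearMap.range h.i.hom :=
      LinearMap.range_comp_of_range_eq_top _
        (LinearMap.range_eq_top.mpr (Function.RightInverse.surjective hpi))
    have key := hP.range (h.i.hom ∘ₗ h.r.hom) hY hY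
    exact prop_of_linearEquiv (N := X)
      ((LinearEquiv.ofEq _ _ hr).trans (LinearEquiv.ofInjective _ hi).symm) key

lemma zero_mem (hP : IsIKEClosed P) (Z : Type v) [AddCommGroup Z] [Module R Z] [Subsingleton Z] :
    P (ModuleCat.of R Z) := by
  have := hP.isStableUnderRetracts
  obtain ⟨M, hM⟩ := hP.nonempty
  exact prop_of_leftInverse (N := M) 0 0 (fun _ => Subsingleton.elim _ _) hM

end IsIKEClosed

end

section

variable {R : Type u} [CommRing R] {P : ObjectProperty (ModuleCat.{u} R)}
  {N : Type u} [AddCommGroup N] [Module R N]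

/-- An IKE-closed subcategory is closed under `Hom(X, -)` for every finitely presented `X`, as
`Hom(X, N)` is the kernel of a map `N ^ p → N ^ q`. -/
lemma IsIKEClosed.hom_mem (hP : IsIKEClosed P) [IsNoetherianRing R] (X : Type u)
    [AddCommGroup X] [Module R X] [Module.Finite R X] (hN : P (ModuleCat.of R N)) :
    P (ModuleCat.of R (X →ₗ[R] N)) := by
  have := hP.isoClosed
  have := hP.kernels
  have := hP.extensions
  obtain ⟨p, π, hπ⟩ := Module.Finite.exists_fin' R X
  obtain ⟨q, ρ, hρ⟩ := Module.Finite.exists_fin' R (LinearMap.ker π)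
  have hex : Function.Exact ((LinearMap.ker π).subtype ∘ₗ ρ) π := by
    rw [LinearMap.exact_iff, LinearMap.range_comp_of_range_eq_top _ (LinearMap.range_eq_top.mpr hρ),
      Submodule.range_subtype]
  have hfree (m : ℕ) : P (ModuleCat.of R ((Fin m → R) →ₗ[R] N)) :=
    prop_of_linearEquiv ((Pi.basisFun R (Fin m)).constr R)
      (prop_pi_fin (hP.zero_mem _) hN m)
  exact prop_of_leftExact _ _ (LinearMap.lcomp_injective_of_surjective π hπ)
    (LinearMap.exact_lcomp_of_exact_of_surjective N hex hπ) (hfree p) (hfree q)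

end

/-! ### Complements and functionals -/

section

/-- Let `𝔪` be an ideal of a `k`-algebra `A` such that `A = k + 𝔪`. If `𝔪 B ⊆ C`, then every
`A`-module between `C` and `B` has a complement relative to these two modules: a complementary
`k`-subspace is automatically an `A`-submodule. -/
lemma exists_relative_complement {k A V : Type*} [Field k] [CommRing A] [Algebra k A]
    [AddCommGroup V] [Module k V] [Module A V] [IsScalarTower k A V] {m : Ideal A}
    (hm : ∀ f : A, ∃ c : k, f - algebraMap k A c ∈ m) {C I B : Submodule A V} (hCI : C ≤ I)
    (hIB : I ≤ B) (hB : ∀ f ∈ m, ∀ b ∈ B, f • b ∈ C) :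
    ∃ J : Submodule A V, C ≤ J ∧ J ≤ B ∧ I ⊓ J = C ∧ I ⊔ J = B := by
  obtain ⟨W, hW⟩ := exists_isCompl (I.restrictScalars k)
  let W' : Submodule k V := (W ⊔ C.restrictScalars k) ⊓ B.restrictScalars k
  have hCW : C.restrictScalars k ≤ W' := le_inf le_sup_right (hCI.trans hIB)
  let J : Submodule A V :=
    { W' with
      smul_mem' := fun f w hw => by
        obtain ⟨c, hc⟩ := hm f
        have h1 : (f - algebraMap k A c) • w ∈ W' := hCW (hB _ hc w hw.2)
        have h2 : c • w ∈ W' := W'.smul_mem c hw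
        rw [sub_smul, algebraMap_smul] at h1
        simpa using W'.add_mem h1 h2 }
  have hJ (w : V) : w ∈ J ↔ w ∈ W ⊔ C.restrictScalars k ∧ w ∈ B := Iff.rfl
  refine ⟨J, hCW, fun w hw => hw.2, le_antisymm ?_ (le_inf hCI hCW), le_antisymm ?_ ?_⟩
  · rintro w ⟨hwI, hwJ⟩
    obtain ⟨p, hp, c, hc, rfl⟩ := Submodule.mem_sup.mp hwJ.1
    have hpI : p ∈ I := by simpa using I.sub_mem hwI (hCI hc)
    have hp0 : p = 0 := Submodule.disjoint_def.mp hW.disjoint p hpI hp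
    simpa [hp0] using hc
  · exact sup_le hIB fun w hw => hw.2
  · intro b hb
    have hb' : b ∈ I.restrictScalars k ⊔ W := hW.sup_eq_top ▸ Submodule.mem_top
    obtain ⟨p, hp, w, hw, rfl⟩ := Submodule.mem_sup.mp hb'
    refine Submodule.add_mem_sup hp ⟨Submodule.mem_sup_left hw, ?_⟩
    simpa using B.sub_mem hb (hIB hp)

lemma exists_linearMap_ne_zero {A N : Type u} [CommRing A] [IsDomain A] [IsNoetherianRing A]
    [AddCommGroup N] [Module A N] [Module.Finite A N] [Module.IsTorsionFree A N] [Nontrivial N] :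
    ∃ f : N →ₗ[A] A, f ≠ 0 := by
  obtain ⟨z, hz⟩ := exists_ne (0 : N)
  let ι := LocalizedModule.mkLinearMap (nonZeroDivisors A) N
  have hιz : ι z ≠ 0 := by
    intro h0
    obtain ⟨s, hs⟩ := (IsLocalizedModule.eq_zero_iff (nonZeroDivisors A) ι).mp h0
    exact hz ((smul_eq_zero.mp hs).resolve_left (nonZeroDivisors.ne_zero s.2))
  obtain ⟨g, hg⟩ : ∃ g : Module.Dual (FractionRing A) (LocalizedModule (nonZeroDivisors A) N),
      g (ι z) ≠ 0 := by
    by_contra! hall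
    exact hιz ((Module.forall_dual_apply_eq_zero_iff (FractionRing A) _).mp hall)
  have : Module.FinitePresentation A N := Module.finitePresentation_of_finite A N
  obtain ⟨f, s, hfs⟩ := Module.FinitePresentation.exists_lift_of_isLocalizedModule
    (nonZeroDivisors A) (Algebra.linearMap A (FractionRing A)) (g.restrictScalars A ∘ₗ ι)
  refine ⟨f, ?_⟩
  rintro rfl
  have h1 : (0 : FractionRing A) = s • g (ι z) := by simpa using congr($hfs z)
  exact hg ((smul_eq_zero.mp h1.symm).resolve_left fun h0 => nonZeroDivisors.ne_zero s.2 h0)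

end

/-! ### Rings whose conductor is generated by a power of an element -/

section

variable {k A : Type*} {S : Type*} [Field k] [CommRing A] [Algebra k A] [CommRing S]
  [Algebra A S]

/-- The submodule `x ^ d S` of an `A`-algebra `S`, for an element `x` of `A`. -/
def powFiltration (S : Type*) [CommRing S] [Algebra A S] (x : A) (d : ℕ) : Submodule A S where
  carrier := {s | algebraMap A S x ^ d ∣ s}
  zero_mem' := dvd_zero _
  add_mem' := dvd_add
  smul_mem' r s hs := by
    rw [Algebra.smul_def]
    exact Dvd.dvd.mul_left hs _

/-- The contraction to `A` of the ideal `x ^ d S` of an `A`-algebra `S`. -/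
def powIdeal (S : Type*) [CommRing S] [Algebra A S] (x : A) (d : ℕ) : Ideal A :=
  (powFiltration S x d).comap (Algebra.linearMap A S)

lemma mem_powFiltration {x : A} {d : ℕ} {s : S} :
    s ∈ powFiltration S x d ↔ algebraMap A S x ^ d ∣ s := Iff.rfl

lemma mem_powIdeal {x f : A} {d : ℕ} :
    f ∈ powIdeal S x d ↔ algebraMap A S x ^ d ∣ algebraMap A S f := Iff.rfl

lemma powFiltration_antitone (x : A) : Antitone (powFiltration S x) :=
  fun _ _ h _ hs => (pow_dvd_pow _ h).trans hs

lemma powIdeal_antitone (x : A) : Antitone (powIdeal S x) :=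
  fun _ _ h _ hs => (pow_dvd_pow _ h).trans hs

variable (k S) in
/-- A ring `A` with residue field `k`, a finite overring `S` and an element `x` of `A` such that
`𝔪 S ⊆ x S` (in the form `A = k + (A ∩ x S)`) and `x ^ n S ⊆ A`. The last field, that every nonzero
`A`-submodule of `S` contains some `x ^ l S`, says that the dimension is one. In the application,
`S = k⟦X⟧` is the normalization of the numerical semigroup ring `A` and `x ^ n S` is the
conductor. -/
structure HasPowConductor (x : A) (n : ℕ) : Prop where
  n_pos : 0 < n
  injective : Function.Injective (algebraMap A S)
  ne_zero : algebraMap A S x ≠ 0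
  not_isUnit : ¬ IsUnit (algebraMap A S x)
  isNoetherian : IsNoetherian A S
  mem_range : ∀ s : S, algebraMap A S x ^ n ∣ s → s ∈ (algebraMap A S).range
  exists_sub_mem : ∀ f : A, ∃ c : k, f - algebraMap k A c ∈ powIdeal S x 1
  exists_le : ∀ I : Submodule A S, I ≠ ⊥ → ∃ l, powFiltration S x l ≤ I

namespace HasPowConductor

variable {x : A} {n : ℕ}

lemma isNoetherianRing (h : HasPowConductor k S x n) : IsNoetherianRing A :=
  have := h.isNoetherian
  isNoetherian_of_injective (Algebra.linearMap A S) h.injective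

lemma isTorsionFree [IsDomain A] [IsDomain S] (h : HasPowConductor k S x n) :
    Module.IsTorsionFree A S :=
  Module.isTorsionFree_iff_algebraMap_injective.mpr h.injective

lemma powIdeal_one_ne_top (h : HasPowConductor k S x n) : powIdeal S x 1 ≠ ⊤ := by
  rw [Ne, Ideal.eq_top_iff_one, mem_powIdeal, map_one, pow_one]
  exact fun h1 => h.not_isUnit (isUnit_of_dvd_one h1)

lemma isMaximal_powIdeal_one (h : HasPowConductor k S x n) : (powIdeal S x 1).IsMaximal := by
  refine Ideal.isMaximal_def.mpr ⟨h.powIdeal_one_ne_top, fun J hJ => ?_⟩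
  obtain ⟨f, hfJ, hf⟩ := SetLike.exists_of_lt hJ
  obtain ⟨c, hc⟩ := h.exists_sub_mem f
  have hc0 : c ≠ 0 := by
    rintro rfl
    exact hf (by simpa using hc)
  have hcJ : algebraMap k A c ∈ J := by simpa using J.sub_mem hfJ (hJ.le hc)
  exact Ideal.eq_top_of_isUnit_mem _ hcJ ((IsUnit.mk0 c hc0).map (algebraMap k A))

/-- `A` is one-dimensional and local. -/
lemma eq_powIdeal_of_isPrime (h : HasPowConductor k S x n) {p : Ideal A} (hp : p.IsPrime)
    (hp0 : p ≠ ⊥) : p = powIdeal S x 1 := by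
  refine (h.isMaximal_powIdeal_one.eq_of_le hp.ne_top fun g hg => ?_).symm
  have hinj : Function.Injective (Algebra.linearMap A S) := h.injective
  obtain ⟨l, hl⟩ := h.exists_le (Submodule.map (Algebra.linearMap A S) p)
    fun hb => hp0 (Submodule.map_injective_of_injective hinj (hb.trans (Submodule.map_bot _).symm))
  have hgl : algebraMap A S (g ^ l) ∈ powFiltration S x l := by
    rw [mem_powFiltration, map_pow]
    exact pow_dvd_pow_of_dvd (by simpa [mem_powIdeal] using hg) l
  obtain ⟨q, hq, hqg⟩ := hl hgl
  exact hp.mem_of_pow_mem l (hinj hqg ▸ hq)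

variable [IsDomain S]

lemma mul_mem_powIdeal_iff (h : HasPowConductor k S x n) {d : ℕ} {f : A} :
    x * f ∈ powIdeal S x (d + 1) ↔ f ∈ powIdeal S x d := by
  rw [mem_powIdeal, mem_powIdeal, pow_succ', map_mul]
  exact mul_dvd_mul_iff_left h.ne_zero

lemma powIdeal_ne_bot (h : HasPowConductor k S x n) (d : ℕ) : powIdeal S x d ≠ ⊥ := fun hbot => by
  have hx : x ^ d ∈ powIdeal S x d := by rw [mem_powIdeal, map_pow]
  rw [hbot, Submodule.mem_bot] at hx
  refine pow_ne_zero d h.ne_zero ?_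
  rw [← map_pow, hx, map_zero]

lemma eq_powIdeal_of_isMaximal (h : HasPowConductor k S x n) {p : Ideal A} (hp : p.IsMaximal) :
    p = powIdeal S x 1 := by
  refine h.eq_powIdeal_of_isPrime hp.isPrime ?_
  rintro rfl
  exact h.powIdeal_ne_bot 1 (hp.eq_of_le h.powIdeal_one_ne_top bot_le).symm

/-- Multiplication by `x ^ d` identifies `S` with `x ^ d S`. -/
noncomputable def powFiltrationEquiv (h : HasPowConductor k S x n) (d : ℕ) :
    S ≃ₗ[A] powFiltration S x d :=
  LinearEquiv.ofBijective
    ((LinearMap.mulLeft A (algebraMap A S x ^ d)).codRestrict (powFiltration S x d)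
      fun _ => Dvd.intro _ rfl)
    ⟨fun _ _ hst => mul_left_cancel₀ (pow_ne_zero d h.ne_zero) (congrArg Subtype.val hst),
      fun ⟨_, t, ht⟩ => ⟨t, Subtype.ext ht.symm⟩⟩

/-- The conductor `x ^ n S` is isomorphic to `S`. -/
noncomputable def powIdealEquiv (h : HasPowConductor k S x n) : S ≃ₗ[A] powIdeal S x n :=
  (h.powFiltrationEquiv n).trans <| LinearEquiv.symm <| LinearEquiv.ofBijective
    ((Algebra.linearMap A S).restrict (p := powIdeal S x n) (q := powFiltration S x n)
      fun _ hf => hf)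
    ⟨fun _ _ hpq => Subtype.ext (h.injective (congrArg Subtype.val hpq)), fun ⟨s, hs⟩ => by
      obtain ⟨f, hf⟩ := h.mem_range s hs
      exact ⟨⟨f, by rwa [mem_powIdeal, hf]⟩, Subtype.ext hf⟩⟩

end HasPowConductor

end

section

variable {k : Type*} {A S : Type u} [Field k] [CommRing A] [Algebra k A] [CommRing S]
  [IsDomain S] [Algebra A S] {x : A} {n : ℕ} {P : ObjectProperty (ModuleCat.{u} A)}

namespace HasPowConductor

/-! ### Torsionfree modules as iterated extensions of the normalization -/

lemma prop_powFiltration [P.IsClosedUnderIsomorphisms] (h : HasPowConductor k S x n)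
    (hS : P (ModuleCat.of A S)) (d : ℕ) : P (ModuleCat.of A (powFiltration S x d)) :=
  prop_of_linearEquiv (h.powFiltrationEquiv d) hS

variable [P.IsStableUnderRetracts] [P.IsClosedUnderExtensions]

/-- The module `x ^ j S / x ^ (j + 1) S` is a `k`-vector space, in which the image of `I` has a
complement. -/
lemma prop_of_le_of_le [Algebra k S] [IsScalarTower k A S] (h : HasPowConductor k S x n)
    (hS : P (ModuleCat.of A S)) {j : ℕ} {I : Submodule A S} (hI : powFiltration S x (j + 1) ≤ I)
    (hI' : I ≤ powFiltration S x j) : P (ModuleCat.of A I) := by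
  obtain ⟨J, -, -, hinf, hsup⟩ := exists_relative_complement h.exists_sub_mem hI hI'
    fun f hf b hb => by
      rw [mem_powFiltration, add_comm, pow_add, Algebra.smul_def]
      exact mul_dvd_mul hf hb
  apply prop_of_inf_sup (B := J)
  · rw [hinf]
    exact h.prop_powFiltration hS _
  · rw [hsup]
    exact h.prop_powFiltration hS _

lemma prop_submodule [Algebra k S] [IsScalarTower k A S] (h : HasPowConductor k S x n)
    (hS : P (ModuleCat.of A S)) (I : Submodule A S) : P (ModuleCat.of A I) := by
  rcases eq_or_ne I ⊥ with rfl | hI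
  · exact prop_of_leftInverse (N := S) 0 0 (fun _ => Subsingleton.elim _ _) hS
  obtain ⟨l, hl⟩ := h.exists_le I hI
  suffices key : ∀ (e j : ℕ) (I : Submodule A S), powFiltration S x (j + e) ≤ I →
      I ≤ powFiltration S x j → P (ModuleCat.of A I) from
    key l 0 I (by simpa using hl) (fun s _ => by simp [mem_powFiltration])
  intro e
  induction e with
  | zero =>
    intro j I h1 h2
    obtain rfl := le_antisymm h2 h1
    exact h.prop_powFiltration hS _
  | succ e ih =>
    intro j I h1 h2
    have hle : powFiltration S x (j + 1) ≤ powFiltration S x j :=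
      powFiltration_antitone x (Nat.le_succ j)
    refine prop_of_inf_sup (B := powFiltration S x (j + 1)) (ih (j + 1) _ ?_ inf_le_right)
      (h.prop_of_le_of_le hS le_sup_right (sup_le h2 hle))
    rw [add_right_comm]
    exact le_inf h1 (powFiltration_antitone x (by omega))

/-- Split off the image of a nonzero functional, which is isomorphic to a submodule of `S`, and
use induction on the rank. -/
lemma prop_of_isTorsionFree [IsDomain A] [Algebra k S] [IsScalarTower k A S]
    (h : HasPowConductor k S x n) (hS : P (ModuleCat.of A S)) (N : Type u) [AddCommGroup N]
    [Module A N] [Module.Finite A N] [Module.IsTorsionFree A N] : P (ModuleCat.of A N) := by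
  have := h.isNoetherianRing
  have := h.isTorsionFree
  induction hr : Module.finrank A N using Nat.strong_induction_on generalizing N with
  | _ r ih =>
  rcases subsingleton_or_nontrivial N with hN | hN
  · exact prop_of_leftInverse (N := S) 0 0 (fun _ => Subsingleton.elim _ _) hS
  obtain ⟨f, hf⟩ := exists_linearMap_ne_zero (A := A) (N := N)
  let g : N →ₗ[A] S := Algebra.linearMap A S ∘ₗ f
  have hg : g ≠ 0 := by
    contrapose! hf
    ext z
    exact h.injective (by simpa [g] using congr($hf z))
  have : Nontrivial (LinearMap.range g) :=
    (Submodule.nontrivial_iff_ne_bot).mpr (by rwa [Ne, LinearMap.range_eq_bot])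
  have hpos : 0 < Module.finrank A (LinearMap.range g) := Module.finrank_pos
  have hadd := (LinearMap.ker g).finrank_quotient_add_finrank
  rw [g.quotKerEquivRange.finrank_eq] at hadd
  exact prop_of_exact (LinearMap.ker g).subtype g.rangeRestrict Subtype.val_injective
    g.surjective_rangeRestrict (by rw [LinearMap.exact_iff]; simp)
    (ih _ (by omega) (LinearMap.ker g) rfl) (h.prop_submodule hS _)

/-! ### Finite length modules as iterated extensions of the residue ring of the conductor -/

/-- Write `C i` for the ideal `A ∩ x ^ i S`. Since `x` maps `C i / C (i + 1)` injectively into the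
`k`-vector space `C (i + 1) / C (i + 2)`, there is an ideal `J` between `C (i + 2)` and `C (i + 1)`
complementary to `x C i + C (i + 2)`, and the sequence
`0 → A ⧸ C (i + 1) → A ⧸ C i × A ⧸ J → A ⧸ C (i + 1) → 0` given by `z ↦ (z, x z)` and
`(z, w) ↦ x z - w` is exact. -/
lemma prop_quotient_powIdeal_of_succ (h : HasPowConductor k S x n) {i : ℕ}
    (hP : P (ModuleCat.of A (A ⧸ powIdeal S x (i + 1)))) :
    P (ModuleCat.of A (A ⧸ powIdeal S x i)) := by
  let μ : A →ₗ[A] A := LinearMap.mulLeft A x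
  have hle21 : powIdeal S x (i + 2) ≤ powIdeal S x (i + 1) := powIdeal_antitone x (Nat.le_succ _)
  obtain ⟨J, hJ, hJ', hinf, hsup⟩ := exists_relative_complement (V := A) h.exists_sub_mem
    (C := powIdeal S x (i + 2)) (B := powIdeal S x (i + 1))
    (I := Submodule.map μ (powIdeal S x i) ⊔ powIdeal S x (i + 2)) le_sup_right
    (sup_le (Submodule.map_le_iff_le_comap.mpr fun z hz => h.mul_mem_powIdeal_iff.mpr hz) hle21)
    fun f hf b hb => by
      rw [mem_powIdeal, show i + 2 = 1 + (i + 1) by ring, pow_add, smul_eq_mul, map_mul]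
      exact mul_dvd_mul hf hb
  have hxJ : powIdeal S x (i + 1) ≤ LinearMap.ker (J.mkQ ∘ₗ μ) := fun z hz =>
    (Submodule.Quotient.mk_eq_zero J).mpr (hJ (h.mul_mem_powIdeal_iff.mpr hz))
  have hle10 : powIdeal S x (i + 1) ≤ LinearMap.ker (powIdeal S x i).mkQ := by
    rw [Submodule.ker_mkQ]
    exact powIdeal_antitone x (Nat.le_succ _)
  have hμ : powIdeal S x i ≤ LinearMap.ker ((powIdeal S x (i + 1)).mkQ ∘ₗ μ) :=
    fun z hz => (Submodule.Quotient.mk_eq_zero _).mpr (h.mul_mem_powIdeal_iff.mpr hz)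
  have hJQ : J ≤ LinearMap.ker (powIdeal S x (i + 1)).mkQ := by rwa [Submodule.ker_mkQ]
  refine prop_fst_of_exact (M' := A ⧸ J)
    ((Submodule.liftQ _ _ hle10).prod (Submodule.liftQ _ _ hxJ))
    ((Submodule.liftQ _ _ hμ).coprod (-Submodule.liftQ _ _ hJQ)) ?_ ?_ ?_ hP hP
  · rw [injective_iff_map_eq_zero]
    intro z hz
    obtain ⟨z, rfl⟩ := Submodule.mkQ_surjective _ z
    have hz1 : z ∈ powIdeal S x i := (Submodule.Quotient.mk_eq_zero _).mp congr(($hz).1)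
    have hz2 : x * z ∈ J := (Submodule.Quotient.mk_eq_zero _).mp congr(($hz).2)
    have hz3 : x * z ∈ powIdeal S x (i + 2) := by
      rw [← hinf]
      exact ⟨Submodule.mem_sup_left ⟨z, hz1, rfl⟩, hz2⟩
    exact (Submodule.Quotient.mk_eq_zero _).mpr (h.mul_mem_powIdeal_iff.mp hz3)
  · intro w
    obtain ⟨w, rfl⟩ := Submodule.mkQ_surjective _ w
    refine ⟨(Submodule.mkQ _ 0, J.mkQ (-w)), ?_⟩
    change Submodule.mkQ (powIdeal S x (i + 1)) (x * 0) +
      -Submodule.mkQ (powIdeal S x (i + 1)) (-w) = _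
    rw [mul_zero, map_zero, map_neg, neg_neg, zero_add]
  · rintro ⟨z, w⟩
    obtain ⟨z, rfl⟩ := Submodule.mkQ_surjective _ z
    obtain ⟨w, rfl⟩ := Submodule.mkQ_surjective _ w
    constructor
    · intro hzw
      have hmem : x * z - w ∈ powIdeal S x (i + 1) := by
        refine (Submodule.Quotient.mk_eq_zero _).mp ?_
        rw [sub_eq_add_neg]
        exact hzw
      rw [← hsup, sup_assoc, sup_eq_right.mpr hJ] at hmem
      obtain ⟨_, ⟨c, hc, rfl⟩, j, hj, hcj⟩ := Submodule.mem_sup.mp hmem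
      refine ⟨Submodule.mkQ _ (z - c), Prod.ext ?_ ?_⟩
      · refine (Submodule.Quotient.eq _).mpr ?_
        simpa using hc
      · refine (Submodule.Quotient.eq _).mpr ?_
        have hcj' : x * c + j = x * z - w := hcj
        have : x * (z - c) - w = j := by linear_combination -hcj'
        change x * (z - c) - w ∈ J
        rwa [this]
    · rintro ⟨y, hy⟩
      obtain ⟨y, rfl⟩ := Submodule.mkQ_surjective _ y
      rw [← hy]
      change Submodule.mkQ (powIdeal S x (i + 1)) (x * y) +
        -Submodule.mkQ (powIdeal S x (i + 1)) (x * y) = 0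
      exact add_neg_cancel _

lemma prop_quotient_powIdeal_one (h : HasPowConductor k S x n)
    (hP : P (ModuleCat.of A (A ⧸ powIdeal S x n))) : P (ModuleCat.of A (A ⧸ powIdeal S x 1)) := by
  suffices key : ∀ m, P (ModuleCat.of A (A ⧸ powIdeal S x (m + 1))) →
      P (ModuleCat.of A (A ⧸ powIdeal S x 1)) by
    have hn := Nat.sub_add_cancel h.n_pos
    exact key (n - 1) (by rwa [hn])
  intro m
  induction m with
  | zero => exact id
  | succ m ih => exact fun hm => ih (h.prop_quotient_powIdeal_of_succ hm)

lemma prop_of_isFiniteLength (h : HasPowConductor k S x n)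
    (hk : P (ModuleCat.of A (A ⧸ powIdeal S x 1))) {M : Type u} [AddCommGroup M] [Module A M]
    (hM : IsFiniteLength A M) : P (ModuleCat.of A M) := by
  induction hM with
  | of_subsingleton =>
    exact prop_of_leftInverse (N := A ⧸ powIdeal S x 1) 0 0 (fun _ => Subsingleton.elim _ _) hk
  | @of_simple_quotient M _ _ N hN _ ih =>
    obtain ⟨p, hp, ⟨e⟩⟩ := isSimpleModule_iff_quot_maximal.mp hN
    rw [h.eq_powIdeal_of_isMaximal hp] at e
    exact prop_of_exact N.subtype N.mkQ Subtype.val_injective N.mkQ_surjective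
      (LinearMap.exact_subtype_mkQ N) ih (prop_of_linearEquiv e.symm hk)

end HasPowConductor

end

/-! ### Four torsionfree subcategories -/

section

variable {A : Type u} [CommRing A]

lemma isStableUnderRetracts_of_isClosedUnderSubobjects {P : ObjectProperty (ModuleCat.{v} A)}
    [P.IsClosedUnderSubobjects] : P.IsStableUnderRetracts where
  of_retract h hY := P.prop_of_mono h.i hY

/-- The image of a morphism is a subobject of its target, and so is a kernel of its source. -/
lemma IsTorsionFreeSubcategory.isIKEClosed {P : ObjectProperty (ModuleCat.{v} A)}
    (hP : IsTorsionFreeSubcategory P) : IsIKEClosed P :=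
  have := hP.subobjects
  { hP.toIsSubcategory with
    images := fun _ _ f _ hN =>
      have : Mono (ModuleCat.ofHom (LinearMap.range f.hom).subtype) :=
        (ModuleCat.mono_iff_injective _).mpr Subtype.val_injective
      P.prop_of_mono (ModuleCat.ofHom (LinearMap.range f.hom).subtype) hN
    kernels := inferInstance
    extensions := hP.extensions }

lemma isTorsionFreeSubcategory_of_modules {P : ObjectProperty (ModuleCat.{v} A)}
    (hfg : P ≤ ModuleCat.isFG A) (h0 : P (ModuleCat.of A PUnit.{v + 1}))
    (hsub : ∀ {M N : Type v} [AddCommGroup M] [Module A M] [AddCommGroup N] [Module A N]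
      (f : M →ₗ[A] N), Function.Injective f → P (ModuleCat.of A N) → P (ModuleCat.of A M))
    (hext : ∀ {L M N : Type v} [AddCommGroup L] [Module A L] [AddCommGroup M] [Module A M]
      [AddCommGroup N] [Module A N] (f : L →ₗ[A] M) (g : M →ₗ[A] N), Function.Injective f →
      Function.Surjective g → Function.Exact f g → P (ModuleCat.of A L) → P (ModuleCat.of A N) →
      P (ModuleCat.of A M)) :
    IsTorsionFreeSubcategory P :=
  have hs : P.IsClosedUnderSubobjects :=
    { prop_of_mono := fun f hf hY =>
        hsub f.hom ((ModuleCat.mono_iff_injective f).mp hf) hY }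
  { le_isFG := hfg
    isoClosed := inferInstance
    nonempty := ⟨_, h0⟩
    subobjects := hs
    extensions :=
      { prop_X₂_of_shortExact := fun {S} hS h₁ h₃ =>
          hext S.f.hom S.g.hom hS.moduleCat_injective_f hS.moduleCat_surjective_g
            ((ShortComplex.ShortExact.moduleCat_exact_iff_function_exact S).mp hS.exact) h₁ h₃ } }

variable (A)

lemma isTorsionFreeSubcategory_zero :
    IsTorsionFreeSubcategory (zeroSubcategory A : ObjectProperty (ModuleCat.{v} A)) := by
  refine isTorsionFreeSubcategory_of_modules ?_ ?_ ?_ ?_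
  · intro M hM
    have : Subsingleton M := hM
    exact (inferInstance : Module.Finite A M)
  · exact (inferInstance : Subsingleton PUnit)
  · intro M N _ _ _ _ f hf hN
    have : Subsingleton N := hN
    exact hf.subsingleton
  · intro L M N _ _ _ _ _ _ f g hf hg hfg hL hN
    have : Subsingleton L := hL
    have : Subsingleton N := hN
    refine subsingleton_of_forall_eq (0 : M) fun z => ?_
    obtain ⟨y, rfl⟩ := (hfg z).mp (Subsingleton.elim _ _)
    rw [Subsingleton.elim y 0, map_zero]

lemma isTorsionFreeSubcategory_fl :
    IsTorsionFreeSubcategory (fl A : ObjectProperty (ModuleCat.{v} A)) := by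
  refine isTorsionFreeSubcategory_of_modules ?_ ?_ ?_ ?_
  · intro M hM
    have := (isFiniteLength_iff_isNoetherian_isArtinian.mp hM).1
    exact (inferInstance : Module.Finite A M)
  · exact IsFiniteLength.of_subsingleton
  · intro M N _ _ _ _ f hf hN
    exact IsFiniteLength.of_injective hN hf
  · intro L M N _ _ _ _ _ _ f g hf hg hfg hL hN
    obtain ⟨_, _⟩ := isFiniteLength_iff_isNoetherian_isArtinian.mp hL
    obtain ⟨_, _⟩ := isFiniteLength_iff_isNoetherian_isArtinian.mp hN
    have h := (LinearMap.exact_iff.mp hfg).symm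
    exact isFiniteLength_iff_isNoetherian_isArtinian.mpr
      ⟨isNoetherian_of_range_eq_ker f g h, isArtinian_of_range_eq_ker f g h⟩

lemma isTorsionFreeSubcategory_isFG [IsNoetherianRing A] :
    IsTorsionFreeSubcategory (ModuleCat.isFG A : ObjectProperty (ModuleCat.{v} A)) := by
  refine isTorsionFreeSubcategory_of_modules le_rfl ?_ ?_ ?_
  · exact (inferInstance : Module.Finite A PUnit.{v + 1})
  · intro M N _ _ _ _ f hf hN
    have : Module.Finite A N := hN
    exact Module.Finite.of_injective f hf
  · intro L M N _ _ _ _ _ _ f g hf hg hfg hL hN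
    have : Module.Finite A L := hL
    have : Module.Finite A N := hN
    exact Module.Finite.of_exact hfg hg

lemma isTorsionFreeSubcategory_tf [IsNoetherianRing A] [IsDomain A] :
    IsTorsionFreeSubcategory (tf A : ObjectProperty (ModuleCat.{v} A)) := by
  have hFG := isTorsionFreeSubcategory_isFG.{u, v} A
  refine isTorsionFreeSubcategory_of_modules (fun M hM => hM.1) ?_ ?_ ?_
  · exact ⟨inferInstance, inferInstance⟩
  · intro M N _ _ _ _ f hf hN
    have : Module.Finite A N := hN.1
    have : Module.IsTorsionFree A N := hN.2
    exact ⟨Module.Finite.of_injective f hf,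
      hf.moduleIsTorsionFree f (fun r m => map_smul f r m)⟩
  · intro L M N _ _ _ _ _ _ f g hf hg hfg hL hN
    have : Module.Finite A L := hL.1
    have : Module.Finite A N := hN.1
    have : Module.IsTorsionFree A L := hL.2
    have : Module.IsTorsionFree A N := hN.2
    refine ⟨Module.Finite.of_exact hfg hg, Module.IsTorsionFree.of_smul_eq_zero fun r z hz => ?_⟩
    refine or_iff_not_imp_left.mpr fun hr => ?_
    have hgz : g z = 0 :=
      (smul_eq_zero.mp (by rw [← map_smul, hz, map_zero] : r • g z = 0)).resolve_left hr
    obtain ⟨y, rfl⟩ := (hfg z).mp hgz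
    have hy : r • y = 0 := hf (by rw [map_smul, hz, map_zero])
    rw [(smul_eq_zero.mp hy).resolve_left hr, map_zero]

variable {A}

/-- A finitely generated module over a noetherian domain has bounded torsion: multiplication by a
suitable `r ≠ 0` has a torsionfree image. -/
lemma exists_range_lsmul_isTorsionFree [IsNoetherianRing A] [IsDomain A] (M : Type v)
    [AddCommGroup M] [Module A M] [Module.Finite A M] :
    ∃ r : A, r ≠ 0 ∧ Module.IsTorsionFree A (LinearMap.range (LinearMap.lsmul A M r)) := by
  obtain ⟨r, hr, hr0⟩ := Submodule.annihilator_top_inter_nonZeroDivisors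
    (Submodule.torsion_isTorsion (R := A) (M := M))
  refine ⟨r, nonZeroDivisors.ne_zero hr0, Module.IsTorsionFree.of_smul_eq_zero ?_⟩
  rintro c ⟨_, z, rfl⟩ hz
  refine or_iff_not_imp_left.mpr fun hc => Subtype.ext ?_
  have hz' : (c * r) • z = 0 := by
    rw [mul_smul]
    exact congrArg Subtype.val hz
  have hzT : z ∈ Submodule.torsion A M :=
    ⟨⟨c * r, mul_mem (mem_nonZeroDivisors_of_ne_zero hc) hr0⟩, hz'⟩
  have hrz : r • (⟨z, hzT⟩ : Submodule.torsion A M) = 0 :=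
    Submodule.mem_annihilator.mp hr _ Submodule.mem_top
  exact (congrArg Subtype.val hrz : r • z = 0)

end

/-! ### The classification -/

section

variable {k : Type*} {A S : Type u} [Field k] [CommRing A] [Algebra k A] [CommRing S]
  [Algebra A S] {x : A} {n : ℕ} {P : ObjectProperty (ModuleCat.{u} A)}

namespace HasPowConductor

/-- Finitely generated torsion modules have finite length, as the nonzero primes are maximal. -/
lemma isFiniteLength_of_smul_eq_zero (h : HasPowConductor k S x n) {M : Type u} [AddCommGroup M]
    [Module A M] [hM : Module.Finite A M] {r : A} (hr : r ≠ 0) (hrM : ∀ z : M, r • z = 0) :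
    IsFiniteLength A M := by
  have := h.isNoetherianRing
  induction hM using IsNoetherianRing.induction_on_isQuotientEquivQuotientPrime A with
  | subsingleton N => exact .of_subsingleton
  | quotient N p e =>
    have hrp : r ∈ p.1 := by
      have := hrM (e.symm 1)
      rw [← map_smul, LinearEquiv.map_eq_zero_iff, ← map_one (Ideal.Quotient.mk p.1)] at this
      simpa using (Submodule.Quotient.mk_eq_zero _).mp this
    have hp := h.eq_powIdeal_of_isPrime p.2 (fun hb => hr (by rwa [hb] at hrp))
    have hmax : p.1.IsMaximal := hp ▸ h.isMaximal_powIdeal_one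
    have hsimple : IsSimpleModule A N := isSimpleModule_iff_quot_maximal.mpr ⟨_, hmax, ⟨e⟩⟩
    exact isFiniteLength_iff_isNoetherian_isArtinian.mpr ⟨inferInstance, inferInstance⟩
  | exact N₁ N₂ N₃ f g hf hg hfg h₁ h₃ =>
    have := (isTorsionFreeSubcategory_fl A).extensions
    refine prop_of_exact (P := fl A) f g hf hg hfg (h₁ fun z => hf ?_) (h₃ fun z => ?_)
    · rw [map_smul, hrM, map_zero]
    · obtain ⟨y, rfl⟩ := hg z
      rw [← map_smul, hrM, map_zero]

variable [IsDomain S]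

lemma extClosure_quotient (h : HasPowConductor k S x n) :
    extClosure (ModuleCat.of A (A ⧸ powIdeal S x n)) = fl A := by
  have hfl := isTorsionFreeSubcategory_fl.{u, u} A
  refine le_antisymm (sInf_le ⟨hfl.toIsSubcategory, ?_, hfl.extensions, ?_⟩) (le_sInf ?_)
  · have := hfl.subobjects
    exact isStableUnderRetracts_of_isClosedUnderSubobjects
  · obtain ⟨r, hr, hr0⟩ := Submodule.exists_mem_ne_zero_of_ne_bot (h.powIdeal_ne_bot n)
    refine h.isFiniteLength_of_smul_eq_zero hr0 fun z => ?_
    obtain ⟨z, rfl⟩ := Submodule.mkQ_surjective _ z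
    exact (Submodule.Quotient.mk_eq_zero _).mpr (Ideal.mul_mem_right z _ hr)
  · rintro P ⟨-, _, _, hP⟩ M hM
    exact h.prop_of_isFiniteLength (h.prop_quotient_powIdeal_one hP) hM

/-- An `A`-linear endomorphism of `S` is `S`-linear, because `x ^ n S ⊆ A`. -/
lemma linearMap_apply (h : HasPowConductor k S x n) (f : S →ₗ[A] S) (s : S) :
    f s = s * f 1 := by
  obtain ⟨b, hb⟩ := h.mem_range (algebraMap A S x ^ n * s) (Dvd.intro _ rfl)
  refine mul_left_cancel₀ (pow_ne_zero n h.ne_zero) ?_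
  have hbs : b • (1 : S) = x ^ n • s := by
    rw [Algebra.smul_def, Algebra.smul_def, mul_one, hb, map_pow]
  calc algebraMap A S x ^ n * f s = f (x ^ n • s) := by rw [map_smul, Algebra.smul_def, map_pow]
    _ = algebraMap A S b * f 1 := by rw [← hbs, map_smul, Algebra.smul_def]
    _ = algebraMap A S x ^ n * (s * f 1) := by rw [hb, mul_assoc]

variable [IsDomain A]

/-- If `M` has torsion, then the residue field is both a submodule and a quotient of `M`, hence the
image of an endomorphism of `M`. -/
lemma quotient_mem_of_not_isTorsionFree (h : HasPowConductor k S x n) (hP : IsIKEClosed P)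
    {M : Type u} [AddCommGroup M] [Module A M] [Module.Finite A M] (hM : P (ModuleCat.of A M))
    (hT : ¬ Module.IsTorsionFree A M) : P (ModuleCat.of A (A ⧸ powIdeal S x 1)) := by
  have := h.isNoetherianRing
  have := hP.isoClosed
  obtain ⟨r, z, hrz, hr, hz⟩ : ∃ (r : A) (z : M), r • z = 0 ∧ r ≠ 0 ∧ z ≠ 0 := by
    rw [Module.isTorsionFree_iff_smul_eq_zero] at hT
    push Not at hT
    exact hT
  obtain ⟨p, hp, hle⟩ := exists_le_isAssociatedPrime_of_isNoetherianRing A z hz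
  obtain ⟨hpp, y, hy⟩ := isAssociatedPrime_iff_exists_injective_linearMap p M |>.mp hp
  have hp1 := h.eq_powIdeal_of_isPrime hpp fun hb => hr (by
    have := hle (Submodule.mem_colon_singleton.mpr hrz)
    rwa [hb] at this)
  subst hp1
  have : Nontrivial M := ⟨z, 0, hz⟩
  obtain ⟨N, hN, -⟩ := (eq_top_or_exists_le_coatom (⊥ : Submodule A M)).resolve_left bot_ne_top
  have hsimple : IsSimpleModule A (M ⧸ N) := isSimpleModule_iff_isCoatom.mpr hN
  obtain ⟨q, hq, ⟨e⟩⟩ := isSimpleModule_iff_quot_maximal.mp hsimple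
  rw [h.eq_powIdeal_of_isMaximal hq] at e
  have hrange : LinearMap.range (y ∘ₗ (e.toLinearMap ∘ₗ N.mkQ)) = LinearMap.range y :=
    LinearMap.range_comp_of_range_eq_top _
      (LinearMap.range_eq_top.mpr (e.surjective.comp N.mkQ_surjective))
  exact prop_of_linearEquiv
    ((LinearEquiv.ofEq _ _ hrange).trans (LinearEquiv.ofInjective y hy).symm) (hP.range _ hM hM)

/-- Let `N` be a nonzero torsionfree module in `P`, and choose a nonzero functional `λ : N → S`.
The image of the map `θ : Hom_A(S, N) → S`, `φ ↦ λ (φ 1)`, is a nonzero ideal of `S`, hence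
isomorphic to `S`. Fix `φ₀` with `θ φ₀` a generator. Then `s ↦ φ₀ (s * ·)` embeds `S` into
`Hom_A(S, N)`, so that this image is isomorphic to that of an endomorphism of `Hom_A(S, N)`, and
`Hom_A(S, N)` belongs to `P`. -/
lemma normalization_mem [IsPrincipalIdealRing S] (h : HasPowConductor k S x n)
    (hP : IsIKEClosed P) {N : Type u} [AddCommGroup N] [Module A N] [Module.Finite A N]
    [Module.IsTorsionFree A N] [Nontrivial N] (hN : P (ModuleCat.of A N)) :
    P (ModuleCat.of A S) := by
  have := h.isNoetherianRing
  have := h.isNoetherian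
  have := h.isTorsionFree
  have := hP.isoClosed
  obtain ⟨l, hl⟩ := exists_linearMap_ne_zero (A := A) (N := N)
  obtain ⟨z, hz⟩ : ∃ z, l z ≠ 0 := by
    by_contra! hall
    exact hl (LinearMap.ext hall)
  let lS : N →ₗ[A] S := Algebra.linearMap A S ∘ₗ l
  let θ : (S →ₗ[A] N) →ₗ[A] S := lS ∘ₗ LinearMap.applyₗ 1
  have hθ (φ : S →ₗ[A] N) (s : S) : lS (φ s) = s * θ φ := h.linearMap_apply (lS ∘ₗ φ) s
  let J : Ideal S :=
    { LinearMap.range θ with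
      smul_mem' := by
        rintro s _ ⟨φ, rfl⟩
        refine ⟨φ ∘ₗ LinearMap.mulLeft A s, ?_⟩
        change lS (φ (s * 1)) = s * θ φ
        rw [mul_one, hθ] }
  obtain ⟨g, hg⟩ := IsPrincipalIdealRing.principal J
  have hmem (s : S) : s ∈ LinearMap.range θ ↔ ∃ t, t * g = s := by
    rw [← Ideal.mem_span_singleton', ← Ideal.submodule_span_eq, ← hg]
    rfl
  obtain ⟨φ₀, hφ₀⟩ := (hmem g).mpr ⟨1, one_mul g⟩
  have hg0 : g ≠ 0 := by
    rintro rfl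
    -- As `S` is isomorphic to an ideal of `A`, it has a nonzero map to `A z`.
    let c : A := h.powIdealEquiv 1
    have hc0 : c ≠ 0 := by simp [c]
    let φ : S →ₗ[A] N := LinearMap.toSpanSingleton A N z ∘ₗ (powIdeal S x n).subtype ∘ₗ
      h.powIdealEquiv.toLinearMap
    obtain ⟨t, ht⟩ := (hmem (θ φ)).mp ⟨φ, rfl⟩
    rw [mul_zero] at ht
    have hθφ : θ φ = algebraMap A S (l (c • z)) := rfl
    rw [hθφ, map_smul, smul_eq_mul] at ht
    exact mul_ne_zero hc0 hz (h.injective (by rw [← ht, map_zero]))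
  let i : S →ₗ[A] (S →ₗ[A] N) := LinearMap.llcomp A S S N φ₀ ∘ₗ LinearMap.mul A S
  have hi : Function.Injective i := by
    rw [injective_iff_map_eq_zero]
    intro s hs
    have h0 : lS (φ₀ (s * 1)) = 0 := by
      have : φ₀ (s * 1) = 0 := congr($hs 1)
      rw [this, map_zero]
    rw [hθ, mul_one, hφ₀] at h0
    exact (mul_eq_zero.mp h0).resolve_right hg0
  have hrange : LinearMap.range (LinearMap.mulRight A g) = LinearMap.range θ := by
    ext s
    rw [hmem]
    rfl
  have hmul : Function.Injective (LinearMap.mulRight A g) := mul_left_injective₀ hg0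
  have hHom : P (ModuleCat.of A (S →ₗ[A] N)) := hP.hom_mem S hN
  exact prop_of_linearEquiv
    ((LinearEquiv.ofEq _ _ (LinearMap.range_comp θ i)).trans <|
      (Submodule.equivMapOfInjective i hi _).symm.trans <|
        (LinearEquiv.ofEq _ _ hrange.symm).trans (LinearEquiv.ofInjective _ hmul).symm)
    (hP.range (i ∘ₗ θ) hHom hHom)

variable [Algebra k S] [IsScalarTower k A S]

lemma tf_le (h : HasPowConductor k S x n) [P.IsStableUnderRetracts] [P.IsClosedUnderExtensions]
    (hS : P (ModuleCat.of A S)) : tf A ≤ P := fun M hM =>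
  have := hM.1
  have := hM.2
  h.prop_of_isTorsionFree hS M

lemma extClosure_powIdeal (h : HasPowConductor k S x n) :
    extClosure (ModuleCat.of A (powIdeal S x n)) = tf A := by
  have := h.isNoetherianRing
  have htf := isTorsionFreeSubcategory_tf.{u, u} A
  refine le_antisymm (sInf_le ⟨htf.toIsSubcategory, ?_, htf.extensions, ?_⟩) (le_sInf ?_)
  · have := htf.subobjects
    exact isStableUnderRetracts_of_isClosedUnderSubobjects
  · exact ⟨inferInstance, inferInstance⟩
  · rintro P ⟨-, _, _, hP⟩
    exact h.tf_le (prop_of_linearEquiv h.powIdealEquiv.symm hP)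

/-- If `P` consists of torsionfree modules, it is `0` or contains the normalization and so `tf`.
Otherwise `fl ⊆ P`; if this is not an equality, then `tf ⊆ P` as well, and every module is an
extension of a torsionfree module by one of finite length. -/
lemma eq_of_isIKEClosed [IsPrincipalIdealRing S] (h : HasPowConductor k S x n)
    (hP : IsIKEClosed P) :
    P = zeroSubcategory A ∨ P = fl A ∨ P = tf A ∨ P = ModuleCat.isFG A := by
  have := h.isNoetherianRing
  have := hP.isStableUnderRetracts
  have := hP.extensions
  by_cases htf : P ≤ tf A
  · by_cases h0 : P ≤ zeroSubcategory A
    · refine .inl (le_antisymm h0 fun M hM => ?_)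
      have : Subsingleton M := hM
      exact hP.zero_mem M
    · obtain ⟨M, hM, hM0⟩ : ∃ M, P M ∧ ¬ zeroSubcategory A M := by
        by_contra! hall
        exact h0 hall
      have := (htf M hM).1
      have := (htf M hM).2
      have : Nontrivial M := not_subsingleton_iff_nontrivial.mp hM0
      exact .inr (.inr (.inl (le_antisymm htf (h.tf_le (h.normalization_mem (N := M) hP hM)))))
  · obtain ⟨M, hM, hMtf⟩ : ∃ M, P M ∧ ¬ tf A M := by
      by_contra! hall
      exact htf hall
    have hfin : Module.Finite A M := hP.le_isFG M hM
    have hfl : fl A ≤ P := fun N hN => h.prop_of_isFiniteLength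
      (h.quotient_mem_of_not_isTorsionFree (M := M) hP hM fun hT => hMtf ⟨hfin, hT⟩) hN
    by_cases hle : P ≤ fl A
    · exact .inr (.inl (le_antisymm hle hfl))
    · obtain ⟨N, hN, hNfl⟩ : ∃ N, P N ∧ ¬ fl A N := by
        by_contra! hall
        exact hle hall
      have : Module.Finite A N := hP.le_isFG N hN
      obtain ⟨r, hr, htors⟩ := exists_range_lsmul_isTorsionFree (A := A) N
      have : Nontrivial (LinearMap.range (LinearMap.lsmul A N r)) := by
        rw [← not_subsingleton_iff_nontrivial]
        intro hsub
        refine hNfl (h.isFiniteLength_of_smul_eq_zero hr fun z => ?_)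
        exact congrArg Subtype.val
          (Subsingleton.elim (⟨r • z, z, rfl⟩ : LinearMap.range (LinearMap.lsmul A N r)) 0)
      have htfP : tf A ≤ P := h.tf_le (h.normalization_mem hP
        (hP.range (LinearMap.lsmul A N r) (M := N) (N := N) hN hN))
      refine .inr (.inr (.inr (le_antisymm hP.le_isFG fun X hX => ?_)))
      have : Module.Finite A X := hX
      obtain ⟨r, hr, htors⟩ := exists_range_lsmul_isTorsionFree (A := A) X
      have hker : IsFiniteLength A (LinearMap.ker (LinearMap.lsmul A X r)) :=
        h.isFiniteLength_of_smul_eq_zero hr fun z => Subtype.ext z.2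
      exact prop_of_exact (LinearMap.ker (LinearMap.lsmul A X r)).subtype
        (LinearMap.lsmul A X r).rangeRestrict Subtype.val_injective
        (LinearMap.surjective_rangeRestrict _) (by rw [LinearMap.exact_iff]; simp)
        (hfl (ModuleCat.of A (LinearMap.ker (LinearMap.lsmul A X r))) hker)
        (htfP (ModuleCat.of A (LinearMap.range (LinearMap.lsmul A X r)))
          ⟨Module.Finite.range _, htors⟩)

lemma isTorsionFreeSubcategory_of_isIKEClosed [IsPrincipalIdealRing S]
    (h : HasPowConductor k S x n) (hP : IsIKEClosed P) : IsTorsionFreeSubcategory P := by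
  have := h.isNoetherianRing
  rcases h.eq_of_isIKEClosed hP with rfl | rfl | rfl | rfl
  · exact isTorsionFreeSubcategory_zero A
  · exact isTorsionFreeSubcategory_fl A
  · exact isTorsionFreeSubcategory_tf A
  · exact isTorsionFreeSubcategory_isFG A

lemma isIKEClosed_iff [IsPrincipalIdealRing S] (h : HasPowConductor k S x n) :
    IsIKEClosed P ↔
      P = zeroSubcategory A ∨ P = fl A ∨ P = tf A ∨ P = ModuleCat.isFG A := by
  have := h.isNoetherianRing
  refine ⟨h.eq_of_isIKEClosed, ?_⟩
  rintro (rfl | rfl | rfl | rfl)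
  · exact (isTorsionFreeSubcategory_zero A).isIKEClosed
  · exact (isTorsionFreeSubcategory_fl A).isIKEClosed
  · exact (isTorsionFreeSubcategory_tf A).isIKEClosed
  · exact (isTorsionFreeSubcategory_isFG A).isIKEClosed

end HasPowConductor

end

/-! ### The numerical semigroup ring -/

lemma mem_consecutiveSemigroup_iff {a r d : ℕ} :
    d ∈ consecutiveSemigroup a r ↔ ∃ m, m * a ≤ d ∧ d ≤ m * (a + r) := by
  constructor
  · intro hd
    induction hd using AddSubmonoid.closure_induction with
    | mem x hx => exact ⟨1, by simpa using hx.1, by simpa using hx.2⟩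
    | zero => exact ⟨0, by simp, by simp⟩
    | add x y _ _ hx hy =>
      obtain ⟨m, hm, hm'⟩ := hx
      obtain ⟨l, hl, hl'⟩ := hy
      exact ⟨m + l, by rw [add_mul]; omega, by rw [add_mul]; omega⟩
  · rintro ⟨m, hm, hm'⟩
    induction m generalizing d with
    | zero =>
      obtain rfl : d = 0 := by simpa using hm'
      exact zero_mem _
    | succ m ih =>
      -- Peel off one generator, taking it as large as the lower bound `m * a` permits.
      obtain ⟨g, hag, hgr, hgd, hlo, hhi⟩ : ∃ g, a ≤ g ∧ g ≤ a + r ∧ g ≤ d ∧ m * a ≤ d - g ∧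
          d - g ≤ m * (a + r) := by
        rw [add_mul, one_mul] at hm hm'
        rcases le_total (d - m * a) (a + r) with h | h
        · refine ⟨d - m * a, by omega, h, by omega, by omega, ?_⟩
          have : m * a ≤ m * (a + r) := Nat.mul_le_mul_left _ (by omega)
          omega
        · exact ⟨a + r, by omega, le_rfl, by omega, by omega, by omega⟩
      have := add_mem (ih hlo hhi) (AddSubmonoid.subset_closure (Set.mem_Icc.mpr ⟨hag, hgr⟩) :
        g ∈ consecutiveSemigroup a r)
      rwa [Nat.sub_add_cancel hgd] at this

/-- The features of `k⟦H⟧`, for `H = ⟨a, …, a + r⟩`, on which the classification rests. Write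
`S = k⟦X⟧` and `x = X ^ a`. The ring `R` contains `x` and `x ^ n S`, it does not contain
`X ^ (a * n - 1)` (so that `x ^ n S` is the conductor), and every element of `R` is the sum of a
constant and of a multiple of `x` in `S` (so that the maximal ideal `𝔪` satisfies `𝔪 S = x S`). -/
structure HasMonomialConductor {k : Type u} [Field k] (R : Subalgebra k (PowerSeries k)) (a n : ℕ) :
    Prop where
  a_pos : 0 < a
  n_pos : 0 < n
  X_pow_mem : PowerSeries.X ^ a ∈ R
  mem_of_dvd : ∀ s : PowerSeries k, PowerSeries.X ^ (a * n) ∣ s → s ∈ R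
  X_pow_notMem : PowerSeries.X ^ (a * n - 1) ∉ R
  exists_dvd_sub : ∀ s ∈ R, ∃ c : k, PowerSeries.X ^ a ∣ s - PowerSeries.C c

lemma X_pow_mem_semigroupRing {k : Type u} [Field k] {H : AddSubmonoid ℕ} {d : ℕ} :
    (PowerSeries.X ^ d : PowerSeries k) ∈ semigroupRing k H ↔ d ∈ H := by
  change (∀ m : ℕ, PowerSeries.coeff m (PowerSeries.X ^ d : PowerSeries k) ≠ 0 → m ∈ H) ↔ d ∈ H
  simp only [PowerSeries.coeff_X_pow]
  constructor
  · intro h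
    exact h d (by simp)
  · intro h m hm
    by_cases hmd : m = d
    · exact hmd ▸ h
    · simp [hmd] at hm

/-- The exponent `n` is the least one with `a - 1 ≤ n * r`, that is, such that the interval
`[n * a, n * (a + r)]` reaches the next one. -/
lemma hasMonomialConductor_semigroupRing (k : Type u) [Field k] {a r : ℕ} (ha : 2 ≤ a)
    (hr : 1 ≤ r) : ∃ n, HasMonomialConductor (semigroupRing k (consecutiveSemigroup a r)) a n := by
  have hex : ∃ n, a - 1 ≤ n * r := ⟨a - 1, Nat.le_mul_of_pos_right _ hr⟩
  obtain ⟨n, hn, hmin⟩ : ∃ n, a - 1 ≤ n * r ∧ ∀ m < n, ¬ a - 1 ≤ m * r := by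
    classical
    exact ⟨Nat.find hex, Nat.find_spec hex, fun m hm => Nat.find_min hex hm⟩
  have hn0 : 0 < n := by
    rcases Nat.eq_zero_or_pos n with rfl | h
    · omega
    · exact h
  refine ⟨n, by omega, hn0, ?_, ?_, ?_, ?_⟩
  · exact X_pow_mem_semigroupRing.mpr (mem_consecutiveSemigroup_iff.mpr ⟨1, by simp, by simp⟩)
  · intro s hs d hd
    have hnd : a * n ≤ d := by
      by_contra hlt
      exact hd (PowerSeries.X_pow_dvd_iff.mp hs d (by omega))
    have hdiv := Nat.div_add_mod d a
    have hmod := Nat.mod_lt d (show 0 < a by omega)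
    have hle : n ≤ d / a := (Nat.le_div_iff_mul_le (by omega)).mpr (by rwa [mul_comm])
    have hle' := Nat.mul_le_mul_right r hle
    refine mem_consecutiveSemigroup_iff.mpr ⟨d / a, Nat.div_mul_le_self d a, ?_⟩
    rw [mul_add, mul_comm (d / a) a]
    omega
  · rw [X_pow_mem_semigroupRing, mem_consecutiveSemigroup_iff]
    rintro ⟨m, hm, hm'⟩
    have han : 0 < a * n := Nat.mul_pos (by omega) hn0
    have hmn : m < n := by
      by_contra hge
      have := Nat.mul_le_mul_right a (not_lt.mp hge)
      rw [mul_comm n a] at this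
      omega
    have := hmin m hmn
    have h2 := Nat.mul_le_mul_left a (show m + 1 ≤ n from hmn)
    rw [mul_add, mul_comm a m] at h2
    rw [mul_add] at hm'
    omega
  · intro s hs
    refine ⟨PowerSeries.coeff 0 s, PowerSeries.X_pow_dvd_iff.mpr fun d hd => ?_⟩
    rw [map_sub, PowerSeries.coeff_C]
    split_ifs with h
    · simp [h]
    · rw [sub_zero]
      by_contra hne
      obtain ⟨m, hm, hm'⟩ := mem_consecutiveSemigroup_iff.mp (hs d hne)
      rcases Nat.eq_zero_or_pos m with rfl | hpos
      · omega
      · have := Nat.mul_le_mul_right a (show 1 ≤ m from hpos)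
        omega

section

variable {k : Type u} [Field k]

/-- The power series of order at least `d`, that is, the ideal `X ^ d k⟦X⟧`, as a module over a
subalgebra `R` of `k⟦X⟧`. -/
noncomputable def orderFiltration (R : Subalgebra k (PowerSeries k)) (d : ℕ) :
    Submodule R (PowerSeries k) where
  carrier := {s | PowerSeries.X ^ d ∣ s}
  zero_mem' := dvd_zero _
  add_mem' := dvd_add
  smul_mem' r _ hs := Dvd.dvd.mul_left hs (r : PowerSeries k)

variable {R : Subalgebra k (PowerSeries k)} {a n d : ℕ}

variable (R d) in
/-- Multiplication by `X ^ d` identifies `k⟦X⟧` with the power series of order at least `d`. -/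
noncomputable def orderFiltrationEquiv : PowerSeries k ≃ₗ[R] orderFiltration R d :=
  LinearEquiv.ofBijective
    ({ toFun := fun s => ⟨PowerSeries.X ^ d * s, Dvd.intro _ rfl⟩
       map_add' := fun s t => Subtype.ext (mul_add _ s t)
       map_smul' := fun r s => Subtype.ext (mul_left_comm _ (r : PowerSeries k) s) } :
      PowerSeries k →ₗ[R] orderFiltration R d)
    ⟨fun _ _ h => mul_left_cancel₀ (pow_ne_zero d PowerSeries.X_ne_zero) (Subtype.ext_iff.mp h),
      fun ⟨_, t, ht⟩ => ⟨t, Subtype.ext ht.symm⟩⟩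

lemma exists_associated_X_pow {s : PowerSeries k} (hs : s ≠ 0) :
    ∃ d, Associated s (PowerSeries.X ^ d) :=
  IsDiscreteValuationRing.associated_pow_irreducible hs PowerSeries.X_prime.irreducible

instance finite_quotient_orderFiltration :
    Module.Finite k (PowerSeries k ⧸ orderFiltration R d) := by
  refine Module.Finite.of_surjective (Fintype.linearCombination k fun i : Fin d =>
    (orderFiltration R d).mkQ (PowerSeries.X ^ (i : ℕ))) fun s => ?_
  obtain ⟨s, rfl⟩ := (orderFiltration R d).mkQ_surjective s
  refine ⟨fun i => PowerSeries.coeff i s, ?_⟩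
  have h : ((orderFiltration R d).mkQ.restrictScalars k)
      (∑ i : Fin d, PowerSeries.coeff i s • PowerSeries.X ^ (i : ℕ) - s) = 0 := by
    refine (Submodule.Quotient.mk_eq_zero _).mpr (PowerSeries.X_pow_dvd_iff.mpr fun m hm => ?_)
    rw [map_sub, map_sum, sub_eq_zero, Finset.sum_eq_single ⟨m, hm⟩]
    · simp [PowerSeries.coeff_X_pow]
    · intro i _ hi
      have : m ≠ i := fun h => hi (Fin.ext h.symm)
      simp [PowerSeries.coeff_X_pow, this]
    · simp
  rw [map_sub, map_sum, sub_eq_zero] at h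
  simpa [Fintype.linearCombination_apply] using h

namespace HasMonomialConductor

lemma orderFiltration_le_span_one (h : HasMonomialConductor R a n) :
    orderFiltration R (a * n) ≤ Submodule.span R {1} := fun s hs =>
  Submodule.mem_span_singleton.mpr ⟨⟨s, h.mem_of_dvd s hs⟩, mul_one s⟩

/-- The quotient of `k⟦X⟧` by `R` is finite-dimensional, as `x ^ n k⟦X⟧ ⊆ R`. -/
lemma finite_powerSeries (h : HasMonomialConductor R a n) : Module.Finite R (PowerSeries k) := by
  have : Module.Finite R (PowerSeries k ⧸ orderFiltration R (a * n)) :=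
    Module.Finite.of_restrictScalars_finite k R _
  have : Module.Finite R (PowerSeries k ⧸ Submodule.span R {(1 : PowerSeries k)}) :=
    Module.Finite.of_surjective _ (Submodule.factor_surjective h.orderFiltration_le_span_one)
  exact Module.Finite.of_submodule_quotient (Submodule.span R {(1 : PowerSeries k)})

/-- If `f` is a nonzero element of order `d` of a submodule, then this submodule contains
`x ^ n k⟦X⟧ f = X ^ (a * n + d) k⟦X⟧`. -/
lemma exists_orderFiltration_le (h : HasMonomialConductor R a n) {I : Submodule R (PowerSeries k)}
    (hI : I ≠ ⊥) : ∃ l, orderFiltration R (a * l) ≤ I := by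
  obtain ⟨f, hf, hf0⟩ := Submodule.exists_mem_ne_zero_of_ne_bot hI
  obtain ⟨d, v, hv⟩ := exists_associated_X_pow hf0
  refine ⟨n + d, fun s hs => ?_⟩
  have hs' : PowerSeries.X ^ (a * n + d) ∣ s :=
    (pow_dvd_pow _ (by
      rw [mul_add]
      exact Nat.add_le_add_left (Nat.le_mul_of_pos_left d h.a_pos) _)).trans hs
  obtain ⟨t, rfl⟩ := hs'
  have hmem := I.smul_mem (⟨PowerSeries.X ^ (a * n) * ((v : PowerSeries k) * t),
    h.mem_of_dvd _ (Dvd.intro _ rfl)⟩ : R) hf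
  convert hmem using 1
  change _ = PowerSeries.X ^ (a * n) * ((v : PowerSeries k) * t) * f
  rw [pow_add, ← hv]
  ring

/-- A nonzero submodule contains `X ^ d k⟦X⟧` for some `d`, and `k⟦X⟧ / X ^ d k⟦X⟧` is
finite-dimensional. -/
lemma isNoetherian_powerSeries (h : HasMonomialConductor R a n) :
    IsNoetherian R (PowerSeries k) := by
  have := h.finite_powerSeries
  refine ⟨fun I => ?_⟩
  rcases eq_or_ne I ⊥ with rfl | hI
  · exact Submodule.fg_bot
  · obtain ⟨l, hl⟩ := h.exists_orderFiltration_le hI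
    have hnoeth : IsNoetherian R (PowerSeries k ⧸ orderFiltration R (a * l)) :=
      isNoetherian_of_tower k inferInstance
    refine Submodule.fg_of_fg_map_of_fg_inf_ker (orderFiltration R (a * l)).mkQ
      (IsNoetherian.noetherian _) ?_
    rw [Submodule.ker_mkQ, inf_eq_right.mpr hl]
    exact Module.Finite.iff_fg.mp (Module.Finite.equiv (orderFiltrationEquiv R (a * l)))

/-- The elements of the total quotient ring that are integral over `R` are the power series. -/
lemma mem_conductor_iff (h : HasMonomialConductor R a n) {f : R} :
    f ∈ conductor R ↔ ∀ s : PowerSeries k, (f : PowerSeries k) * s ∈ R := by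
  have := h.finite_powerSeries
  have hinj : Function.Injective (Algebra.ofId R (FractionRing (PowerSeries k))) := by
    intro p q hpq
    exact Subtype.ext (IsFractionRing.injective (PowerSeries k) (FractionRing (PowerSeries k)) hpq)
  let φ : FractionRing R →ₐ[R] FractionRing (PowerSeries k) := IsFractionRing.liftAlgHom hinj
  have hφ : Function.Injective φ := φ.toRingHom.injective
  have hφR (p : R) : φ (algebraMap R (FractionRing R) p) =
      algebraMap (PowerSeries k) (FractionRing (PowerSeries k)) p := φ.commutes p
  have hS := IsFractionRing.injective (PowerSeries k) (FractionRing (PowerSeries k))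
  -- A power series `s` is the fraction `(x ^ n s) / x ^ n`.
  have hA (s : PowerSeries k) : ∃ y ∈ integralClosure R (FractionRing R),
      φ y = algebraMap (PowerSeries k) (FractionRing (PowerSeries k)) s := by
    let p : R := ⟨PowerSeries.X ^ (a * n) * s, h.mem_of_dvd _ (Dvd.intro _ rfl)⟩
    let q : R := ⟨PowerSeries.X ^ (a * n), h.mem_of_dvd _ dvd_rfl⟩
    have hq : algebraMap (PowerSeries k) (FractionRing (PowerSeries k)) q ≠ 0 :=
      (map_ne_zero_iff _ hS).mpr (pow_ne_zero _ PowerSeries.X_ne_zero)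
    have hy : φ (algebraMap R _ p / algebraMap R _ q) =
        algebraMap (PowerSeries k) (FractionRing (PowerSeries k)) s := by
      rw [map_div₀, hφR, hφR, div_eq_iff hq, ← map_mul, mul_comm]
    refine ⟨_, (isIntegral_algHom_iff φ hφ).mp ?_, hy⟩
    rw [hy]
    exact (Algebra.IsIntegral.isIntegral (R := R) s).algebraMap
  have hB (y : FractionRing R) (hy : y ∈ integralClosure R (FractionRing R)) :
      ∃ s, algebraMap (PowerSeries k) (FractionRing (PowerSeries k)) s = φ y :=
    IsIntegrallyClosed.isIntegral_iff.mp
      (((isIntegral_algHom_iff φ hφ).mpr hy).tower_top (A := PowerSeries k))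
  simp only [conductor, Submodule.mem_comap, Submodule.mem_div_iff_forall_mul_mem,
    Submodule.mem_one, Algebra.linearMap_apply, Subalgebra.mem_toSubmodule]
  constructor
  · intro hf s
    obtain ⟨y, hy, hys⟩ := hA s
    obtain ⟨g, hg⟩ := hf y hy
    have : (f : PowerSeries k) * s = g := hS (by rw [map_mul, ← hφR, ← hφR, ← hys, ← map_mul φ, hg])
    exact this ▸ g.2
  · intro hf y hy
    obtain ⟨s, hs⟩ := hB y hy
    exact ⟨⟨_, hf s⟩, hφ (by rw [hφR, map_mul φ, hφR, ← hs, ← map_mul])⟩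

/-- An element `f` of order `d < a * n` is not in the conductor, as a power series multiple of `f`
is `X ^ (a * n - 1)`, which is not in `R`. -/
lemma conductor_eq (h : HasMonomialConductor R a n) : conductor R =
    powIdeal (PowerSeries k) (⟨PowerSeries.X ^ a, h.X_pow_mem⟩ : R) n := by
  ext f
  rw [h.mem_conductor_iff, mem_powIdeal]
  change _ ↔ (PowerSeries.X ^ a) ^ n ∣ (f : PowerSeries k)
  rw [← pow_mul]
  constructor
  · intro hf
    rcases eq_or_ne (f : PowerSeries k) 0 with h0 | h0
    · exact h0 ▸ dvd_zero _
    · obtain ⟨d, hd'⟩ := exists_associated_X_pow h0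
      obtain ⟨v, hv⟩ := id hd'
      rcases lt_or_ge d (a * n) with hd | hd
      · refine absurd (hf ((v : PowerSeries k) * PowerSeries.X ^ (a * n - 1 - d))) ?_
        rw [← mul_assoc, hv, ← pow_add, show d + (a * n - 1 - d) = a * n - 1 by omega]
        exact h.X_pow_notMem
      · exact (pow_dvd_pow _ hd).trans hd'.dvd'
  · exact fun hf s => h.mem_of_dvd _ (hf.mul_right s)

lemma hasPowConductor (h : HasMonomialConductor R a n) :
    HasPowConductor k (PowerSeries k) (⟨PowerSeries.X ^ a, h.X_pow_mem⟩ : R) n where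
  n_pos := h.n_pos
  injective := Subtype.val_injective
  ne_zero := pow_ne_zero a PowerSeries.X_ne_zero
  not_isUnit hu := PowerSeries.X_prime.not_isUnit ((isUnit_pow_iff h.a_pos.ne').mp hu)
  isNoetherian := h.isNoetherian_powerSeries
  mem_range s hs := by
    have hs' : (PowerSeries.X ^ a) ^ n ∣ s := hs
    rw [← pow_mul] at hs'
    exact ⟨⟨s, h.mem_of_dvd s hs'⟩, rfl⟩
  exists_sub_mem f := by
    obtain ⟨c, hc⟩ := h.exists_dvd_sub f f.2
    refine ⟨c, ?_⟩
    rw [mem_powIdeal, pow_one]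
    exact hc
  exists_le I hI := by
    obtain ⟨l, hl⟩ := h.exists_orderFiltration_le hI
    refine ⟨l, fun s hs => hl ?_⟩
    have hs' : (PowerSeries.X ^ a) ^ l ∣ s := hs
    rwa [← pow_mul] at hs'

end HasMonomialConductor

end

end IKE

theorem theorem6p7 (k : Type u) [Field k] [Infinite k] (a r : ℕ) (ha : 2 ≤ a) (hr : 1 ≤ r)
    (R : Subalgebra k (PowerSeries k))
    (hR : R = IKE.semigroupRing k (IKE.consecutiveSemigroup a r)) :
    (IKE.extClosure (ModuleCat.of R (R ⧸ IKE.conductor R)) = IKE.fl R ∧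
      IKE.extClosure (ModuleCat.of R (IKE.conductor R)) = IKE.tf R) ∧
    (∀ P : ObjectProperty (ModuleCat.{u} R), IKE.IsIKEClosed P ↔
      P = IKE.zeroSubcategory R ∨ P = IKE.fl R ∨ P = IKE.tf R ∨ P = ModuleCat.isFG R) ∧
    (∀ P : ObjectProperty (ModuleCat.{u} R),
      IKE.IsIKEClosed P → IKE.IsTorsionFreeSubcategory P) := by
  obtain ⟨n, h⟩ := IKE.hasMonomialConductor_semigroupRing k ha hr
  subst hR
  rw [h.conductor_eq]
  exact ⟨⟨h.hasPowConductor.extClosure_quotient, h.hasPowConductor.extClosure_powIdeal⟩,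
    fun P => h.hasPowConductor.isIKEClosed_iff,
    fun P hP => h.hasPowConductor.isTorsionFreeSubcategory_of_isIKEClosed hP⟩
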